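/- **Theorem 5.5 (doubling).** *Definitions.* Let $\delta\ge 0$. A metric space $X$ is $\delta$-hyperbolic if $(x|z)_p\ge\min\{(x|y)_p,(y|z)_p\}-\delta$ for all $p,x,y,z\in X$, where $(x|y)_p=\frac12\big(d(p,x)+d(p,y)-d(x,y)\big)$. Its ideal boundary $\partial X$ is the set of equivalence classes of sequences $(x_i)$ with $(x_i|x_j)_p\to\infty$ as $i,j\to\infty$, where $(x_i)\sim(y_i)$ if $(x_i|y_i)_p\to\infty$. $X$ has *bounded growth at some scale* if there are $R>r>0$ and an integer $N\ge1$ such that every open ball of radius $R$ in $X$ can be covered by $N$ open balls of radius $r$. A metric space is *doubling* if there is a constant $N$ such that every open ball of radius $R>0$ can be covered by at most $N$ open balls of radius $R/2$. For $\xi\in\partial X$, $p\in X$ and a geodesic ray $\gamma$ from $p$ to $\xi$ put $B_\gamma(x)=\lim_{t\to\infty}\big(d(\gamma(t),x)-t\big)$, and let $B_{\xi,p}(x)=\sup_\gamma B_\gamma(x)$ over all geodesic rays $\gamma$ from $p$ to $\xi$. For $\eta_1\ne\eta_2$ in $\partial X\setminus\{\xi\}$ let $H_{\xi,p}(\eta_1,\eta_2)=\inf_\sigma\inf_{x\in\sigma}B_{\xi,p}(x)$,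 where $\sigma$ runs over all complete geodesics from $\eta_1$ to $\eta_2$ (with $\sup\emptyset=-\infty$, $\inf\emptyset=+\infty$), and for $\epsilon>0$ let $D_{\xi,p,\epsilon}(\eta_1,\eta_2)=e^{-\epsilon H_{\xi,p}(\eta_1,\eta_2)}\in[0,\infty]$. A *parabolic visual metric* $d_{\xi,p,\epsilon}$ is a metric on $\partial X\setminus\{\xi\}$ such that $\frac12D_{\xi,p,\epsilon}(\eta_1,\eta_2)\le d_{\xi,p,\epsilon}(\eta_1,\eta_2)\le D_{\xi,p,\epsilon}(\eta_1,\eta_2)$ for all $\eta_1\ne\eta_2$ in $\partial X\setminus\{\xi\}$. *Statement.* For every $\delta\ge0$ there is a constant $\epsilon_0>0$, depending only on $\delta$, such that the following holds. Let $X$ be a $\delta$-hyperbolic geodesic metric space with bounded growth at some scale, let $\xi\in\partial X$ and $p\in X$. 1. If $X$ is proper and $0<\epsilon\le\epsilon_0$, then a parabolic visual metric $d_{\xi,p,\epsilon}$ on $\partial X\setminus\{\xi\}$ exists. 2. For every $\epsilon>0$ (in particular for $0<\epsilon\le\epsilon_0$) and every parabolic visual metric $d_{\xi,p,\epsilon}$,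 the metric space $(\partial X\setminus\{\xi\},d_{\xi,p,\epsilon})$ is doubling. -/

import Mathlib

open Filter Topology
open scoped NNReal ENNReal

universe u

noncomputable section

namespace ParabolicVisual

/-- A geodesic metric space: any two points are joined by an isometrically embedded segment. -/
def IsGeodesicSpace (X : Type u) [MetricSpace X] : Prop :=
  ∀ x y : X, ∃ γ : ℝ → X, γ 0 = x ∧ γ (dist x y) = y ∧
    ∀ s ∈ Set.Icc (0 : ℝ) (dist x y), ∀ t ∈ Set.Icc (0 : ℝ) (dist x y),
      dist (γ s) (γ t) = |s - t|

/-- The Gromov product `(x|y)_p`. -/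
def gromovProduct {X : Type u} [MetricSpace X] (p x y : X) : ℝ :=
  (dist p x + dist p y - dist x y) / 2

/-- `δ`-hyperbolicity in the sense of Gromov (the four-point condition). -/
def IsHyperbolic (δ : ℝ) (X : Type u) [MetricSpace X] : Prop :=
  ∀ p x y z : X,
    min (gromovProduct p x y) (gromovProduct p y z) - δ ≤ gromovProduct p x z

/-- Bounded growth at some scale: there are `R > r > 0` and `N ≥ 1` such that every open ball of
radius `R` is covered by `N` open balls of radius `r`. -/
def HasBoundedGrowthAtSomeScale (X : Type u) [MetricSpace X] : Prop :=
  ∃ r R : ℝ, 0 < r ∧ r < R ∧ ∃ N : ℕ, 1 ≤ N ∧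
    ∀ x : X, ∃ s : Finset X, s.card ≤ N ∧ Metric.ball x R ⊆ ⋃ c ∈ s, Metric.ball c r

/-- A doubling metric space: there is `N` such that every open ball of radius `R > 0` is covered
by at most `N` open balls of radius `R / 2`. -/
def IsDoubling (Y : Type u) [MetricSpace Y] : Prop :=
  ∃ N : ℕ, ∀ y : Y, ∀ R : ℝ, 0 < R →
    ∃ s : Finset Y, s.card ≤ N ∧ Metric.ball y R ⊆ ⋃ c ∈ s, Metric.ball c (R / 2)

/-- A sequence converging at infinity: `(x_i|x_j)_p → ∞` as `i, j → ∞`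
(for one, equivalently every, base point `p`). -/
def ConvergesAtInfinity {X : Type u} [MetricSpace X] (x : ℕ → X) : Prop :=
  ∀ p : X, Tendsto (fun ij : ℕ × ℕ => gromovProduct p (x ij.1) (x ij.2)) atTop atTop

/-- Two sequences converging at infinity are equivalent if `(x_i|y_i)_p → ∞`. -/
def EquivAtInfinity {X : Type u} [MetricSpace X] (x y : ℕ → X) : Prop :=
  ∀ p : X, Tendsto (fun i : ℕ => gromovProduct p (x i) (y i)) atTop atTop

/-- The Gromov boundary `∂X`: the set of equivalence classes of sequences converging at infinity
(for hyperbolic `X` the relation `EquivAtInfinity` is an equivalence relation on them). -/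
def Boundary (X : Type u) [MetricSpace X] : Type u :=
  {c : Set (ℕ → X) // ∃ x : ℕ → X, ConvergesAtInfinity x ∧
    c = {y | ConvergesAtInfinity y ∧ EquivAtInfinity x y}}

/-- The sequence `x` converges to the boundary point `ξ`. -/
def ConvergesTo {X : Type u} [MetricSpace X] (x : ℕ → X) (ξ : Boundary X) : Prop :=
  x ∈ ξ.1

/-- `γ : [0, ∞) → X` is a geodesic ray from `p` to `ξ`. -/
def IsRay {X : Type u} [MetricSpace X] (p : X) (ξ : Boundary X) (γ : ℝ≥0 → X) : Prop :=
  Isometry γ ∧ γ 0 = p ∧ ConvergesTo (fun n : ℕ => γ (n : ℝ≥0)) ξ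

/-- `σ : ℝ → X` is a complete geodesic from `η₁` to `η₂`. -/
def IsCompleteGeodesic {X : Type u} [MetricSpace X] (η₁ η₂ : Boundary X) (σ : ℝ → X) : Prop :=
  Isometry σ ∧ ConvergesTo (fun n : ℕ => σ (-(n : ℝ))) η₁ ∧
    ConvergesTo (fun n : ℕ => σ (n : ℝ)) η₂

/-- `B_γ(x) = lim_{t → ∞} (d(γ(t), x) - t)`; the limit exists for every geodesic ray `γ`. -/
def rayBusemann {X : Type u} [MetricSpace X] (γ : ℝ≥0 → X) (x : X) : ℝ :=
  limUnder atTop (fun t : ℝ≥0 => dist (γ t) x - (t : ℝ))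

/-- The Busemann function `B_{ξ,p}`: the supremum of `B_γ` over the rays `γ` from `p` to `ξ`.
It is real-valued as soon as there is such a ray. -/
def busemann {X : Type u} [MetricSpace X] (ξ : Boundary X) (p x : X) : EReal :=
  ⨆ (γ : ℝ≥0 → X) (_ : IsRay p ξ γ), (rayBusemann γ x : EReal)

/-- `H_{ξ,p}(σ)`, the infimum of the Busemann function over the complete geodesic `σ`. -/
def heightAlong {X : Type u} [MetricSpace X] (ξ : Boundary X) (p : X) (σ : ℝ → X) : EReal :=
  ⨅ t : ℝ, busemann ξ p (σ t)

/-- `H_{ξ,p}(η₁, η₂)`, the infimum of `H_{ξ,p}(σ)` over the complete geodesics `σ` from `η₁`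
to `η₂`. -/
def height {X : Type u} [MetricSpace X] (ξ : Boundary X) (p : X) (η₁ η₂ : Boundary X) : EReal :=
  ⨅ (σ : ℝ → X) (_ : IsCompleteGeodesic η₁ η₂ σ), heightAlong ξ p σ

/-- `D_{ξ,p,ε}(η₁, η₂) = exp (-ε H_{ξ,p}(η₁, η₂))`, with `exp (-∞) = 0` and `exp ∞ = ∞`. -/
def parabolicKernel {X : Type u} [MetricSpace X] (ξ : Boundary X) (p : X) (ε : ℝ)
    (η₁ η₂ : Boundary X) : ℝ≥0∞ :=
  EReal.exp (-((ε : EReal) * height ξ p η₁ η₂))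

/-- The punctured boundary `∂X ∖ {ξ}`. -/
abbrev PuncturedBoundary {X : Type u} [MetricSpace X] (ξ : Boundary X) : Type u :=
  {η : Boundary X // η ≠ ξ}

/-- The metric `d` on `∂X ∖ {ξ}` is a parabolic visual metric `d_{ξ,p,ε}`:
`D_{ξ,p,ε} / 2 ≤ d ≤ D_{ξ,p,ε}` on pairs of distinct points. -/
def IsParabolicVisualMetric {X : Type u} [MetricSpace X] (ξ : Boundary X) (p : X) (ε : ℝ)
    (d : MetricSpace (PuncturedBoundary ξ)) : Prop :=
  ∀ η₁ η₂ : PuncturedBoundary ξ, η₁ ≠ η₂ →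
    parabolicKernel ξ p ε η₁ η₂ / 2 ≤ ENNReal.ofReal (d.dist η₁ η₂) ∧
      ENNReal.ofReal (d.dist η₁ η₂) ≤ parabolicKernel ξ p ε η₁ η₂

end ParabolicVisual

end

/-! For a Busemann function `b` of a ray to `ξ`, the relative product `(x|y)_b` is a limit of
`(x|y)_{γ t} - t`, so it satisfies the four-point inequality with the same `δ`. Up to multiples of
`δ`, the height of a pair is the product of its endpoints relative to `b`
(`le_height_of_le_relProduct`, `IsCompleteGeodesic.sub_le_relProduct`). Hence `D = exp (-εH)` is a
quasi-ultrametric with constant `exp (10δε)` (`sub_le_height`), and for small `ε` Frink's chain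
construction turns it into a metric between `D/2` and `D`.

For doubling, take a ball of radius `ρ = exp (-ε h₀)` about `y`. Each of its points `x` at distance
at least `ρ/2` from `y` has height close to `h₀` relative to `y`, so some geodesic from `y` to `x`
has a point at Busemann level about `h₀`. Such points are mutually close, since the geodesics share
the end `y` (`dist_le_of_isCompleteGeodesic`). Moving a fixed length `T` towards `x` gives a point
`q` in a set of bounded diameter. If two such points are `2r`-close, their endpoints are `ρ/2`-close
(`le_height_of_dist_le`). Bounded growth covers the set by boundedly many `r`-balls
(`exists_card_le_cover`). -/

namespace ParabolicVisual

/-! ### Gromov products relative to a Lipschitz function. -/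

section RelativeProduct

variable {X : Type u} [MetricSpace X] {δ : ℝ} {b : X → ℝ}

/-- The Gromov product `(x|y)_b` relative to a function `b`, for instance the distance to a point
or a Busemann function. -/
noncomputable def relProduct (b : X → ℝ) (x y : X) : ℝ := (b x + b y - dist x y) / 2

/-- `b` is `1`-Lipschitz and its relative Gromov product satisfies the four-point condition. -/
structure IsHyperbolicFrom (δ : ℝ) (b : X → ℝ) : Prop where
  le_add_dist : ∀ x y, b x ≤ b y + dist x y
  min_sub_le : ∀ x y z, min (relProduct b x y) (relProduct b y z) - δ ≤ relProduct b x z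

theorem relProduct_comm (b : X → ℝ) (x y : X) : relProduct b x y = relProduct b y x := by
  unfold relProduct; rw [dist_comm x y]; ring

theorem relProduct_dist (p x y : X) : relProduct (dist p) x y = gromovProduct p x y := rfl

theorem IsHyperbolic.isHyperbolicFrom_dist (h : IsHyperbolic δ X) (p : X) :
    IsHyperbolicFrom δ (dist p) where
  le_add_dist x y := by
    have := dist_triangle p y x
    rwa [dist_comm y x] at this
  min_sub_le := h p

theorem IsHyperbolicFrom.sub_le (hb : IsHyperbolicFrom δ b) {x y z : X} {L : ℝ}
    (h₁ : L ≤ relProduct b x y) (h₂ : L ≤ relProduct b y z) : L - δ ≤ relProduct b x z :=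
  (sub_le_sub_right (le_min h₁ h₂) δ).trans (hb.min_sub_le x y z)

theorem IsHyperbolicFrom.sub_two_mul_le (hδ : 0 ≤ δ) (hb : IsHyperbolicFrom δ b)
    {x y z w : X} {L : ℝ} (h₁ : L ≤ relProduct b x y) (h₂ : L ≤ relProduct b y z)
    (h₃ : L ≤ relProduct b z w) : L - 2 * δ ≤ relProduct b x w := by
  have := hb.sub_le (hb.sub_le h₁ h₂) (by linarith : L - δ ≤ relProduct b z w)
  linarith

theorem IsHyperbolicFrom.relProduct_le (hb : IsHyperbolicFrom δ b) {x y z : X}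
    (h : dist x z + dist z y = dist x y) : relProduct b x y ≤ b z := by
  have h₁ := hb.le_add_dist x z
  have h₂ := hb.le_add_dist y z
  rw [dist_comm y z] at h₂
  unfold relProduct
  linarith

/-- Here `z` is the balance point of a segment: its products with `x` and `y` both equal the mean of
`(x|y)_b` and `b z`, so the four-point inequality through `z` suffices. -/
theorem IsHyperbolicFrom.le_relProduct (hb : IsHyperbolicFrom δ b) {x y z : X}
    (h₁ : dist x z = (dist x y + b x - b y) / 2) (h₂ : dist z y = (dist x y - b x + b y) / 2) :
    b z ≤ relProduct b x y + 2 * δ := by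
  have e₁ : relProduct b x z = (relProduct b x y + b z) / 2 := by
    unfold relProduct; rw [h₁]; ring
  have e₂ : relProduct b z y = (relProduct b x y + b z) / 2 := by
    unfold relProduct; rw [h₂]; ring
  have := hb.sub_le e₁.ge e₂.ge
  linarith

theorem IsHyperbolicFrom.sub_le_relProduct_of_isometry (hb : IsHyperbolicFrom δ b) {σ : ℝ → X}
    (hσ : Isometry σ) {m : ℝ} (hm : ∀ t, m ≤ b (σ t)) (s t : ℝ) :
    m - 2 * δ ≤ relProduct b (σ s) (σ t) := by
  wlog hst : s ≤ t generalizing s t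
  · rw [relProduct_comm]; exact this t s (le_of_not_ge hst)
  have hd : dist (σ s) (σ t) = t - s := by
    rw [hσ.dist_eq, dist_comm, Real.dist_eq, abs_of_nonneg (by linarith)]
  have h₁ := hb.le_add_dist (σ s) (σ t)
  have h₂ := hb.le_add_dist (σ t) (σ s)
  rw [dist_comm (σ t)] at h₂
  have := hb.le_relProduct (x := σ s) (y := σ t)
    (z := σ (s + (dist (σ s) (σ t) + b (σ s) - b (σ t)) / 2))
    (by rw [hσ.dist_eq, dist_comm, Real.dist_eq, add_sub_cancel_left, abs_of_nonneg (by linarith)])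
    (by rw [hσ.dist_eq (s + _), dist_comm, Real.dist_eq, abs_of_nonneg (by linarith)]; linarith)
  linarith [hm (s + (dist (σ s) (σ t) + b (σ s) - b (σ t)) / 2)]

theorem IsHyperbolicFrom.relProduct_le_of_isometry (hb : IsHyperbolicFrom δ b) {σ : ℝ → X}
    (hσ : Isometry σ) {s t u : ℝ} (h₁ : s ≤ t) (h₂ : t ≤ u) :
    relProduct b (σ s) (σ u) ≤ b (σ t) := by
  apply hb.relProduct_le
  simp only [hσ.dist_eq, Real.dist_eq]
  rw [abs_of_nonpos, abs_of_nonpos, abs_of_nonpos] <;> linarith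

end RelativeProduct

/-! ### Sequences at infinity and their boundary points. -/

section Boundary

variable {X : Type u} [MetricSpace X] {δ : ℝ}

theorem gromovProduct_comm (p x y : X) : gromovProduct p x y = gromovProduct p y x :=
  relProduct_comm _ x y

theorem gromovProduct_nonneg (p x y : X) : 0 ≤ gromovProduct p x y := by
  have := dist_triangle_left x y p
  unfold gromovProduct; linarith

theorem gromovProduct_le_add_dist (p q x y : X) :
    gromovProduct p x y ≤ gromovProduct q x y + dist p q := by
  have h₁ := dist_triangle p q x
  have h₂ := dist_triangle p q y
  unfold gromovProduct; linarith

theorem gromovProduct_le_dist (p x y : X) : gromovProduct p x y ≤ dist p x := by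
  have := dist_triangle p x y
  unfold gromovProduct; linarith

theorem gromovProduct_le_add_dist_left (p x x' y : X) :
    gromovProduct p x y ≤ gromovProduct p x' y + dist x x' := by
  have h₁ := dist_triangle p x' x
  have h₂ := dist_triangle x' x y
  rw [dist_comm x' x] at h₁ h₂
  unfold gromovProduct; linarith

theorem convergesAtInfinity_iff {x : ℕ → X} (p : X) :
    ConvergesAtInfinity x ↔
      ∀ M : ℝ, ∃ N : ℕ, ∀ i ≥ N, ∀ j ≥ N, M ≤ gromovProduct p (x i) (x j) := by
  constructor
  · intro h M
    obtain ⟨⟨a, c⟩, hac⟩ := eventually_atTop.1 ((h p).eventually_ge_atTop M)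
    exact ⟨max a c, fun i hi j hj => hac (i, j)
      ⟨(le_max_left _ _).trans hi, (le_max_right _ _).trans hj⟩⟩
  · intro h q
    refine tendsto_atTop.2 fun M => ?_
    obtain ⟨N, hN⟩ := h (M + dist p q)
    filter_upwards [eventually_ge_atTop (N, N)] with ij hij
    linarith [hN ij.1 hij.1 ij.2 hij.2, gromovProduct_le_add_dist p q (x ij.1) (x ij.2)]

theorem equivAtInfinity_iff {x y : ℕ → X} (p : X) :
    EquivAtInfinity x y ↔ Tendsto (fun i => gromovProduct p (x i) (y i)) atTop atTop := by
  refine ⟨fun h => h p, fun h q => ?_⟩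
  refine tendsto_atTop.2 fun M => ?_
  filter_upwards [tendsto_atTop.1 h (M + dist p q)] with i hi
  linarith [gromovProduct_le_add_dist p q (x i) (y i)]

theorem ConvergesAtInfinity.equivAtInfinity_self {x : ℕ → X} (h : ConvergesAtInfinity x) :
    EquivAtInfinity x x := fun p =>
  (h p).comp tendsto_atTop_diagonal

theorem EquivAtInfinity.symm {x y : ℕ → X} (h : EquivAtInfinity x y) : EquivAtInfinity y x :=
  fun p => by simpa only [gromovProduct_comm] using h p

theorem EquivAtInfinity.trans (hX : IsHyperbolic δ X) {x y z : ℕ → X}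
    (h : EquivAtInfinity x y) (h' : EquivAtInfinity y z) : EquivAtInfinity x z := fun p => by
  refine tendsto_atTop.2 fun M => ?_
  filter_upwards [tendsto_atTop.1 (h p) (M + δ), tendsto_atTop.1 (h' p) (M + δ)] with i h₁ h₂
  have := (hX.isHyperbolicFrom_dist p).sub_le h₁ h₂
  rw [relProduct_dist] at this
  linarith

theorem ConvergesTo.convergesAtInfinity {x : ℕ → X} {ξ : Boundary X} (h : ConvergesTo x ξ) :
    ConvergesAtInfinity x := by
  obtain ⟨c, x₀, h₀, rfl⟩ := ξ
  exact h.1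

theorem ConvergesTo.equivAtInfinity (hX : IsHyperbolic δ X) {x y : ℕ → X} {ξ : Boundary X}
    (hx : ConvergesTo x ξ) (hy : ConvergesTo y ξ) : EquivAtInfinity x y := by
  obtain ⟨c, x₀, h₀, rfl⟩ := ξ
  exact hx.2.symm.trans hX hy.2

theorem ConvergesTo.of_equiv (hX : IsHyperbolic δ X) {x y : ℕ → X} {ξ : Boundary X}
    (hx : ConvergesTo x ξ) (hy : ConvergesAtInfinity y) (hxy : EquivAtInfinity x y) :
    ConvergesTo y ξ := by
  obtain ⟨c, x₀, h₀, rfl⟩ := ξ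
  exact ⟨hy, hx.2.trans hX hxy⟩

theorem eq_of_equivAtInfinity (hX : IsHyperbolic δ X) {x y : ℕ → X} {ξ η : Boundary X}
    (hx : ConvergesTo x ξ) (hy : ConvergesTo y η) (hxy : EquivAtInfinity x y) : ξ = η := by
  apply Subtype.ext
  ext z
  exact ⟨fun hz => hy.of_equiv hX (ConvergesTo.convergesAtInfinity hz)
      (hxy.symm.trans hX (hx.equivAtInfinity hX hz)),
    fun hz => hx.of_equiv hX (ConvergesTo.convergesAtInfinity hz)
      (hxy.trans hX (hy.equivAtInfinity hX hz))⟩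

theorem exists_convergesTo (ξ : Boundary X) : ∃ x, ConvergesTo x ξ := by
  obtain ⟨c, x₀, h₀, rfl⟩ := ξ
  exact ⟨x₀, h₀, h₀.equivAtInfinity_self⟩

/-- Sequences converging to different boundary points have bounded Gromov products. -/
theorem exists_gromovProduct_le (hδ : 0 ≤ δ) (hX : IsHyperbolic δ X) {x y : ℕ → X}
    {ξ η : Boundary X} (hx : ConvergesTo x ξ) (hy : ConvergesTo y η) (hne : ξ ≠ η) (p : X) :
    ∃ M : ℝ, ∃ N : ℕ, ∀ i ≥ N, ∀ j ≥ N, gromovProduct p (x i) (y j) ≤ M := by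
  have hxy : ¬ EquivAtInfinity x y := fun h => hne (eq_of_equivAtInfinity hX hx hy h)
  rw [equivAtInfinity_iff p, tendsto_atTop] at hxy
  push Not at hxy
  obtain ⟨M, hM⟩ := hxy
  obtain ⟨N₁, h₁⟩ := (convergesAtInfinity_iff p).1 hx.convergesAtInfinity (M + 2 * δ)
  obtain ⟨N₂, h₂⟩ := (convergesAtInfinity_iff p).1 hy.convergesAtInfinity (M + 2 * δ)
  obtain ⟨n, hn, hnM⟩ := frequently_atTop.1 hM (max N₁ N₂)
  have hn₁ := (le_max_left _ _).trans hn
  have hn₂ := (le_max_right _ _).trans hn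
  refine ⟨M + 2 * δ, max N₁ N₂, fun i hi j hj => ?_⟩
  -- One large cross product would, via `x i` and `y j`, push the product at the index `n` up to
  -- `M`.
  by_contra! hlt
  have := (hX.isHyperbolicFrom_dist p).sub_two_mul_le hδ
    (h₁ n hn₁ i ((le_max_left _ _).trans hi)) hlt.le
    (h₂ j ((le_max_right _ _).trans hj) n hn₂)
  rw [relProduct_dist] at this
  linarith

end Boundary

/-! ### Busemann functions of rays, and their products. -/

section Busemann

variable {X : Type u} [MetricSpace X] {δ : ℝ} {p : X} {ξ : Boundary X} {γ : ℝ≥0 → X}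

/-- By the triangle inequality the function of `t` is antitone and bounded below; this makes the
`limUnder` a genuine limit. -/
theorem tendsto_rayBusemann (hγ : Isometry γ) (x : X) :
    Tendsto (fun t : ℝ≥0 => dist (γ t) x - (t : ℝ)) atTop (𝓝 (rayBusemann γ x)) := by
  have hanti : Antitone fun t : ℝ≥0 => dist (γ t) x - (t : ℝ) := by
    intro s t hst
    have h := dist_triangle (γ t) (γ s) x
    rw [hγ.dist_eq, NNReal.dist_eq, abs_of_nonneg (sub_nonneg.2 (by exact_mod_cast hst))] at h
    simp only
    linarith
  have hbdd : BddBelow (Set.range fun t : ℝ≥0 => dist (γ t) x - (t : ℝ)) := by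
    refine ⟨-dist (γ 0) x, ?_⟩
    rintro _ ⟨t, rfl⟩
    have h := dist_triangle_right (γ t) (γ 0) x
    rw [hγ.dist_eq, NNReal.dist_eq, NNReal.coe_zero, sub_zero,
      abs_of_nonneg t.coe_nonneg] at h
    simp only
    linarith
  exact tendsto_nhds_limUnder ⟨_, tendsto_atTop_ciInf hanti hbdd⟩

theorem isHyperbolicFrom_rayBusemann (hX : IsHyperbolic δ X) (hγ : Isometry γ) :
    IsHyperbolicFrom δ (rayBusemann γ) where
  le_add_dist x y := by
    refine le_of_tendsto_of_tendsto' (tendsto_rayBusemann hγ x)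
      ((tendsto_rayBusemann hγ y).add_const (dist x y)) fun t => ?_
    linarith [dist_triangle_right (γ t) x y]
  min_sub_le x y z := by
    have key : ∀ x y, Tendsto (fun t : ℝ≥0 => gromovProduct (γ t) x y - (t : ℝ)) atTop
        (𝓝 (relProduct (rayBusemann γ) x y)) := fun x y => by
      refine ((((tendsto_rayBusemann hγ x).add (tendsto_rayBusemann hγ y)).sub_const
        (dist x y)).div_const 2).congr fun t => ?_
      unfold gromovProduct; ring
    refine le_of_tendsto_of_tendsto' (((key x y).min (key y z)).sub_const δ) (key x z) fun t => ?_
    have := hX (γ t) x y z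
    rw [min_sub_sub_right]
    linarith

/-- Change of base point from `ξ` to `p`: for a ray from `p`, the subtracted terms are the limiting
Gromov products of `x` and `y` with the ray. -/
theorem relProduct_rayBusemann (γ : ℝ≥0 → X) (p x y : X) :
    relProduct (rayBusemann γ) x y = gromovProduct p x y - (dist p x - rayBusemann γ x) / 2 -
      (dist p y - rayBusemann γ y) / 2 := by
  unfold relProduct gromovProduct; ring

/-- The Gromov product of `ξ` with a sequence converging to another point is bounded. -/
theorem exists_sub_rayBusemann_le (hδ : 0 ≤ δ) (hX : IsHyperbolic δ X) (hγ : IsRay p ξ γ)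
    {x : ℕ → X} {η : Boundary X} (hx : ConvergesTo x η) (hne : η ≠ ξ) :
    ∃ M : ℝ, ∀ᶠ n in atTop, (dist p (x n) - rayBusemann γ (x n)) / 2 ≤ M := by
  obtain ⟨M, N, h⟩ := exists_gromovProduct_le hδ hX hx hγ.2.2 hne p
  refine ⟨M, eventually_atTop.2 ⟨N, fun n hn => ?_⟩⟩
  have hlim : Tendsto (fun m : ℕ => gromovProduct p (x n) (γ (m : ℝ≥0))) atTop
      (𝓝 ((dist p (x n) - rayBusemann γ (x n)) / 2)) := by
    refine (((tendsto_rayBusemann hγ.1 (x n)).comp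
      tendsto_natCast_atTop_atTop).const_sub (dist p (x n))).div_const 2 |>.congr fun m => ?_
    have : dist p (γ (m : ℝ≥0)) = m := by
      rw [← hγ.2.1, hγ.1.dist_eq, NNReal.dist_eq]; simp
    unfold gromovProduct
    rw [this, dist_comm (x n) (γ _)]
    simp only [Function.comp, NNReal.coe_natCast]
    ring
  exact le_of_tendsto hlim (eventually_atTop.2 ⟨N, fun m hm => h n hn m hm⟩)

theorem tendsto_relProduct_rayBusemann (hδ : 0 ≤ δ) (hX : IsHyperbolic δ X) (hγ : IsRay p ξ γ)
    {x y : ℕ → X} {η : Boundary X} (hx : ConvergesTo x η) (hy : ConvergesTo y η) (hne : η ≠ ξ) :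
    Tendsto (fun n => relProduct (rayBusemann γ) (x n) (y n)) atTop atTop := by
  obtain ⟨M, hM⟩ := exists_sub_rayBusemann_le hδ hX hγ hx hne
  obtain ⟨M', hM'⟩ := exists_sub_rayBusemann_le hδ hX hγ hy hne
  refine tendsto_atTop.2 fun L => ?_
  filter_upwards [hM, hM', tendsto_atTop.1 (hx.equivAtInfinity hX hy p) (L + M + M')]
    with n h₁ h₂ h₃
  rw [relProduct_rayBusemann γ p]
  linarith

theorem gromovProduct_of_isometry (hγ : Isometry γ) {s t : ℝ≥0} (hst : s ≤ t) :
    gromovProduct (γ 0) (γ s) (γ t) = s := by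
  have hst' : (s : ℝ) ≤ t := hst
  simp only [gromovProduct, hγ.dist_eq, NNReal.dist_eq, NNReal.coe_zero, zero_sub, abs_neg]
  rw [abs_of_nonneg s.coe_nonneg, abs_of_nonneg t.coe_nonneg, abs_of_nonpos (by linarith)]
  ring

/-- At equal times the two rays are `4δ`-close: compare them through far points, with which each `γ
t` has product exactly `t`. So the supremum over rays costs only `4δ`. -/
theorem rayBusemann_le_add (hδ : 0 ≤ δ) (hX : IsHyperbolic δ X) {γ' : ℝ≥0 → X}
    (hγ : IsRay p ξ γ) (hγ' : IsRay p ξ γ') (x : X) :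
    rayBusemann γ' x ≤ rayBusemann γ x + 4 * δ := by
  have hd : ∀ t, dist (γ' t) (γ t) ≤ 4 * δ := fun t => by
    obtain ⟨n, hn, htn⟩ := ((tendsto_atTop.1 (hγ'.2.2.equivAtInfinity hX hγ.2.2 p) t).and
      (eventually_ge_atTop ⌈t⌉₊)).exists
    have htn' : t ≤ (n : ℝ≥0) := Nat.ceil_le.1 htn
    have h₁ := gromovProduct_of_isometry hγ.1 htn'
    have h₂ := gromovProduct_of_isometry hγ'.1 htn'
    rw [hγ.2.1, gromovProduct_comm] at h₁
    rw [hγ'.2.1] at h₂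
    have := (hX.isHyperbolicFrom_dist p).sub_two_mul_le hδ h₂.ge hn h₁.ge
    have e₁ : dist p (γ t) = t := by rw [← hγ.2.1, hγ.1.dist_eq, NNReal.dist_eq]; simp
    have e₂ : dist p (γ' t) = t := by rw [← hγ'.2.1, hγ'.1.dist_eq, NNReal.dist_eq]; simp
    unfold relProduct at this
    linarith
  refine le_of_tendsto_of_tendsto' (tendsto_rayBusemann hγ'.1 x)
    ((tendsto_rayBusemann hγ.1 x).add_const (4 * δ)) fun t => ?_
  linarith [hd t, dist_triangle (γ' t) (γ t) x]

theorem rayBusemann_le_busemann (hγ : IsRay p ξ γ) (x : X) :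
    (rayBusemann γ x : EReal) ≤ busemann ξ p x :=
  le_iSup₂ (f := fun (γ : ℝ≥0 → X) (_ : IsRay p ξ γ) => (rayBusemann γ x : EReal)) γ hγ

theorem busemann_le_rayBusemann (hδ : 0 ≤ δ) (hX : IsHyperbolic δ X) (hγ : IsRay p ξ γ) (x : X) :
    busemann ξ p x ≤ ((rayBusemann γ x + 4 * δ : ℝ) : EReal) :=
  iSup₂_le fun _ hγ' => EReal.coe_le_coe_iff.2 (rayBusemann_le_add hδ hX hγ hγ' x)

end Busemann

/-! ### Height as a product relative to the Busemann function. -/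

section Height

variable {X : Type u} [MetricSpace X] {δ : ℝ} {p : X} {ξ η₁ η₂ η₃ : Boundary X} {γ : ℝ≥0 → X}

theorem IsCompleteGeodesic.height_le {σ : ℝ → X} (hσ : IsCompleteGeodesic η₁ η₂ σ) (t : ℝ) :
    height ξ p η₁ η₂ ≤ busemann ξ p (σ t) :=
  (iInf₂_le σ hσ).trans (iInf_le _ t)

/-- Every `σ t` lies between `σ (-n)` and `σ n`, so its Busemann value is at least their product,
which two four-point steps compare with that of `x n` and `y n`. -/
theorem le_height_of_le_relProduct (hδ : 0 ≤ δ) (hX : IsHyperbolic δ X) (hγ : IsRay p ξ γ)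
    {x y : ℕ → X} (hx : ConvergesTo x η₁) (hy : ConvergesTo y η₂) (h₁ : η₁ ≠ ξ) (h₂ : η₂ ≠ ξ)
    {L : ℝ} (hL : ∀ᶠ n in atTop, L ≤ relProduct (rayBusemann γ) (x n) (y n)) :
    ((L - 2 * δ : ℝ) : EReal) ≤ height ξ p η₁ η₂ := by
  refine le_iInf₂ fun σ hσ => le_iInf fun t => ?_
  refine le_trans (EReal.coe_le_coe_iff.2 ?_) (rayBusemann_le_busemann hγ (σ t))
  have hb := isHyperbolicFrom_rayBusemann hX hγ.1
  obtain ⟨n, hn, h₁, h₂, hnt⟩ := (hL.and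
    ((tendsto_atTop.1 (tendsto_relProduct_rayBusemann hδ hX hγ hσ.2.1 hx h₁) L).and
    ((tendsto_atTop.1 (tendsto_relProduct_rayBusemann hδ hX hγ hy hσ.2.2 h₂) L).and
    (eventually_ge_atTop ⌈|t|⌉₊)))).exists
  have hnt' := abs_le.1 (Nat.ceil_le.1 hnt)
  exact (hb.sub_two_mul_le hδ h₁ hn h₂).trans
    (hb.relProduct_le_of_isometry hσ.1 hnt'.1 hnt'.2)

theorem IsCompleteGeodesic.sub_le_rayBusemann (hδ : 0 ≤ δ) (hX : IsHyperbolic δ X)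
    (hγ : IsRay p ξ γ) {σ : ℝ → X} (hσ : IsCompleteGeodesic η₁ η₂ σ) {L : ℝ}
    (hL : (L : EReal) ≤ height ξ p η₁ η₂) (t : ℝ) : L - 4 * δ ≤ rayBusemann γ (σ t) := by
  have := EReal.coe_le_coe_iff.1
    ((hL.trans (hσ.height_le t)).trans (busemann_le_rayBusemann hδ hX hγ _))
  linarith

theorem IsCompleteGeodesic.sub_le_relProduct (hδ : 0 ≤ δ) (hX : IsHyperbolic δ X)
    (hγ : IsRay p ξ γ) {σ : ℝ → X} (hσ : IsCompleteGeodesic η₁ η₂ σ) {L : ℝ}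
    (hL : (L : EReal) ≤ height ξ p η₁ η₂) (s t : ℝ) :
    L - 6 * δ ≤ relProduct (rayBusemann γ) (σ s) (σ t) := by
  have := (isHyperbolicFrom_rayBusemann hX hγ.1).sub_le_relProduct_of_isometry hσ.1
    (hσ.sub_le_rayBusemann hδ hX hγ hL) s t
  linarith

/-- The quasi-ultrametric inequality. The loss is `6δ` from heights to products, `2δ` for the chain
through `η₂`, and `2δ` back to heights. -/
theorem sub_le_height (hδ : 0 ≤ δ) (hX : IsHyperbolic δ X) (hγ : IsRay p ξ γ)
    (h₁ : η₁ ≠ ξ) (h₂ : η₂ ≠ ξ) (h₃ : η₃ ≠ ξ) {σ τ : ℝ → X}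
    (hσ : IsCompleteGeodesic η₁ η₂ σ) (hτ : IsCompleteGeodesic η₂ η₃ τ) {L : ℝ}
    (hL : (L : EReal) ≤ height ξ p η₁ η₂) (hL' : (L : EReal) ≤ height ξ p η₂ η₃) :
    ((L - 10 * δ : ℝ) : EReal) ≤ height ξ p η₁ η₃ := by
  have := le_height_of_le_relProduct hδ hX hγ hσ.2.1 hτ.2.2 h₁ h₃ (L := L - 8 * δ) ?_
  · convert this using 2; ring
  · filter_upwards [tendsto_atTop.1
      (tendsto_relProduct_rayBusemann hδ hX hγ hσ.2.2 hτ.2.1 h₂) (L - 6 * δ)] with n hn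
    have := (isHyperbolicFrom_rayBusemann hX hγ.1).sub_two_mul_le hδ
      (hσ.sub_le_relProduct hδ hX hγ hL (-(n : ℝ)) n) hn
      (hτ.sub_le_relProduct hδ hX hγ hL' (-(n : ℝ)) n)
    linarith

theorem height_ne_bot (hδ : 0 ≤ δ) (hX : IsHyperbolic δ X) (hγ : IsRay p ξ γ)
    (h₁ : η₁ ≠ ξ) (h₂ : η₂ ≠ ξ) : height ξ p η₁ η₂ ≠ ⊥ := by
  obtain ⟨x, hx⟩ := exists_convergesTo η₁
  obtain ⟨y, hy⟩ := exists_convergesTo η₂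
  obtain ⟨M, hM⟩ := exists_sub_rayBusemann_le hδ hX hγ hx h₁
  obtain ⟨M', hM'⟩ := exists_sub_rayBusemann_le hδ hX hγ hy h₂
  refine ne_bot_of_le_ne_bot (EReal.coe_ne_bot _)
    (le_height_of_le_relProduct hδ hX hγ hx hy h₁ h₂ (L := -M - M') ?_)
  filter_upwards [hM, hM'] with n h h'
  rw [relProduct_rayBusemann γ p]
  linarith [gromovProduct_nonneg p (x n) (y n)]

theorem height_ne_top (hδ : 0 ≤ δ) (hX : IsHyperbolic δ X) (hγ : IsRay p ξ γ) {σ : ℝ → X}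
    (hσ : IsCompleteGeodesic η₁ η₂ σ) : height ξ p η₁ η₂ ≠ ⊤ :=
  ne_top_of_le_ne_top (EReal.coe_ne_top _)
    ((hσ.height_le 0).trans (busemann_le_rayBusemann hδ hX hγ _))

theorem height_comm (ξ : Boundary X) (p : X) (η₁ η₂ : Boundary X) :
    height ξ p η₁ η₂ = height ξ p η₂ η₁ := by
  have key : ∀ η₁ η₂ : Boundary X, height ξ p η₁ η₂ ≤ height ξ p η₂ η₁ := by
    intro η₁ η₂
    refine le_iInf₂ fun σ hσ => le_iInf fun t => ?_
    have hσ' : IsCompleteGeodesic η₁ η₂ fun t => σ (-t) :=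
      ⟨hσ.1.comp (IsometryEquiv.neg ℝ).isometry, by simpa using hσ.2.2, hσ.2.1⟩
    simpa using hσ'.height_le (ξ := ξ) (p := p) (-t)
  exact le_antisymm (key _ _) (key _ _)

theorem parabolicKernel_of_height_eq {ε h : ℝ} (hh : height ξ p η₁ η₂ = h) :
    parabolicKernel ξ p ε η₁ η₂ = ENNReal.ofReal (Real.exp (-(ε * h))) := by
  rw [parabolicKernel, hh, ← EReal.coe_mul, ← EReal.coe_neg, EReal.exp_coe]

end Height

/-! ### Rays and complete geodesics in proper spaces. -/

section Existence

variable {X : Type u} [MetricSpace X] {δ : ℝ}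

/-- Arzelà–Ascoli by an ultrafilter, without diagonal extraction. Isometry is asked only eventually
for each pair, as segments have growing domains. -/
theorem exists_isometry_limit [ProperSpace X] {A : Type*} [PseudoMetricSpace A] (l : Ultrafilter ℕ)
    {f : ℕ → A → X} (hf : ∀ a b, ∀ᶠ k in l, dist (f k a) (f k b) = dist a b) (p : X) {a₀ : A}
    {C : ℝ} (hC : ∀ᶠ k in l, dist (f k a₀) p ≤ C) :
    ∃ g : A → X, Isometry g ∧ ∀ a, Tendsto (fun k => f k a) l (𝓝 (g a)) := by
  have hlim : ∀ a, ∃ x, Tendsto (fun k => f k a) l (𝓝 x) := fun a => by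
    have hK := isCompact_closedBall p (dist a a₀ + C)
    obtain ⟨x, -, hx⟩ := hK.ultrafilter_le_nhds (l.map fun k => f k a) <| by
      rw [le_principal_iff]
      show ∀ᶠ k in l, f k a ∈ Metric.closedBall p (dist a a₀ + C)
      filter_upwards [hf a a₀, hC] with k h₁ h₂
      rw [Metric.mem_closedBall]
      linarith [dist_triangle (f k a) (f k a₀) p]
    exact ⟨x, hx⟩
  choose g hg using hlim
  refine ⟨g, Isometry.of_dist_eq fun a b => ?_, hg⟩
  exact tendsto_nhds_unique ((hg a).dist (hg b))
    (tendsto_const_nhds.congr' ((hf a b).mono fun _ h => h.symm))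

theorem convergesTo_of_le_gromovProduct (hX : IsHyperbolic δ X) {x w : ℕ → X} {η : Boundary X}
    (hx : ConvergesTo x η) (p : X) {l : Filter ℕ} [l.NeBot] (hl : l ≤ atTop) {C : ℝ}
    (h : ∀ n : ℕ, ∀ᶠ k in l, (n : ℝ) - C ≤ gromovProduct p (w n) (x k)) : ConvergesTo w η := by
  have hb := hX.isHyperbolicFrom_dist p
  refine hx.of_equiv hX ((convergesAtInfinity_iff p).2 fun M => ?_)
    (EquivAtInfinity.symm ((equivAtInfinity_iff p).2 (tendsto_atTop.2 fun M => ?_)))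
  · refine ⟨⌈M + C + δ⌉₊, fun i hi j hj => ?_⟩
    have hi' := Nat.ceil_le.1 hi
    have hj' := Nat.ceil_le.1 hj
    obtain ⟨k, h₁, h₂⟩ := ((h i).and (h j)).exists
    rw [gromovProduct_comm] at h₂
    have := hb.sub_le (L := M + δ) (y := x k) (x := w i) (z := w j)
      (by rw [relProduct_dist]; linarith) (by rw [relProduct_dist]; linarith)
    rw [relProduct_dist] at this
    linarith
  · obtain ⟨N, hN⟩ := (convergesAtInfinity_iff p).1 hx.convergesAtInfinity (M + δ)
    filter_upwards [eventually_ge_atTop N, eventually_ge_atTop ⌈M + C + δ⌉₊] with n hn hn'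
    have hn'' := Nat.ceil_le.1 hn'
    obtain ⟨k, h₁, h₂⟩ := ((h n).and (hl (eventually_ge_atTop N))).exists
    have := hb.sub_le (L := M + δ) (x := w n) (y := x k) (z := x n)
      (by rw [relProduct_dist]; linarith) (hN k h₂ n hn)
    rw [relProduct_dist] at this
    linarith

theorem ConvergesTo.tendsto_dist {x : ℕ → X} {η : Boundary X} (hx : ConvergesTo x η) (p : X) :
    Tendsto (fun n => dist p (x n)) atTop atTop :=
  tendsto_atTop_mono (fun _ => gromovProduct_le_dist _ _ _)
    (hx.convergesAtInfinity.equivAtInfinity_self p)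

theorem exists_isRay [ProperSpace X] (hG : IsGeodesicSpace X) (hX : IsHyperbolic δ X) (p : X)
    (ξ : Boundary X) : ∃ γ, IsRay p ξ γ := by
  obtain ⟨x, hx⟩ := exists_convergesTo ξ
  choose f hf₀ hf₁ hf using fun k => hG p (x k)
  have hl : (hyperfilter ℕ : Filter ℕ) ≤ atTop := Nat.hyperfilter_le_atTop
  have hlarge : ∀ T : ℝ, ∀ᶠ k in (hyperfilter ℕ : Filter ℕ), T ≤ dist p (x k) := fun T =>
    hl (tendsto_atTop.1 (hx.tendsto_dist p) T)
  obtain ⟨γ, hγ, hlim⟩ := exists_isometry_limit (hyperfilter ℕ)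
    (f := fun k (t : ℝ≥0) => f k t) (fun a b => by
      filter_upwards [hlarge a, hlarge b] with k h₁ h₂
      exact hf k _ ⟨a.2, h₁⟩ _ ⟨b.2, h₂⟩) p (a₀ := 0) (C := 0)
      (Eventually.of_forall fun k => by simp [hf₀])
  refine ⟨γ, hγ, tendsto_nhds_unique (hlim 0) ?_,
    convergesTo_of_le_gromovProduct hX hx p hl (C := 1) fun n => ?_⟩
  · simp [hf₀]
  · filter_upwards [hlarge n, (hlim n).eventually (Metric.ball_mem_nhds _ one_pos)] with k h₁ h₂
    have h₃ := gromovProduct_le_add_dist_left p (f k (n : ℝ≥0)) (γ n) (x k)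
    have hn : ((n : ℝ≥0) : ℝ) ∈ Set.Icc (0 : ℝ) (dist p (x k)) := ⟨by simp, by simpa using h₁⟩
    have e₁ := hf k 0 ⟨le_rfl, dist_nonneg⟩ _ hn
    have e₂ := hf k _ hn (dist p (x k)) ⟨dist_nonneg, le_rfl⟩
    rw [hf₀, zero_sub, abs_neg, abs_of_nonneg hn.1] at e₁
    rw [hf₁, abs_of_nonpos (by linarith [hn.2])] at e₂
    have e₃ : gromovProduct p (f k (n : ℝ≥0)) (x k) = n := by
      unfold gromovProduct; rw [e₁, e₂, NNReal.coe_natCast]; ring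
    linarith

theorem exists_isCompleteGeodesic [ProperSpace X] (hδ : 0 ≤ δ) (hG : IsGeodesicSpace X)
    (hX : IsHyperbolic δ X) (p : X) {η₁ η₂ : Boundary X} (hne : η₁ ≠ η₂) :
    ∃ σ, IsCompleteGeodesic η₁ η₂ σ := by
  obtain ⟨x, hx⟩ := exists_convergesTo η₁
  obtain ⟨y, hy⟩ := exists_convergesTo η₂
  obtain ⟨M, N, hM⟩ := exists_gromovProduct_le hδ hX hx hy hne p
  choose f hf₀ hf₁ hf using fun k => hG (x k) (y k)
  have hl : (hyperfilter ℕ : Filter ℕ) ≤ atTop := Nat.hyperfilter_le_atTop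
  -- `a k` and `c k` split the segment at its balance point for `dist p`. Taking that point as time
  -- `0` keeps the segments within `M + 2δ` of `p`, while both ends escape.
  set a : ℕ → ℝ := fun k => gromovProduct (x k) p (y k) with ha
  set c : ℕ → ℝ := fun k => gromovProduct (y k) p (x k) with hc
  have hac : ∀ k, a k + c k = dist (x k) (y k) := fun k => by
    simp only [ha, hc, gromovProduct, dist_comm (y k) (x k), dist_comm (x k) p, dist_comm (y k) p]
    ring
  have ha₀ : ∀ k, 0 ≤ a k := fun k => gromovProduct_nonneg _ _ _
  have hc₀ : ∀ k, 0 ≤ c k := fun k => gromovProduct_nonneg _ _ _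
  have hM' : ∀ᶠ k in (hyperfilter ℕ : Filter ℕ), gromovProduct p (x k) (y k) ≤ M :=
    hl (eventually_atTop.2 ⟨N, fun k hk => hM k hk k hk⟩)
  have haT : ∀ T : ℝ, ∀ᶠ k in (hyperfilter ℕ : Filter ℕ), T ≤ a k := fun T => by
    filter_upwards [hM', hl (tendsto_atTop.1 (hx.tendsto_dist p) (T + M))] with k h₁ h₂
    have : a k + gromovProduct p (x k) (y k) = dist p (x k) := by
      simp only [ha, gromovProduct, dist_comm (x k) p]; ring
    linarith
  have hcT : ∀ T : ℝ, ∀ᶠ k in (hyperfilter ℕ : Filter ℕ), T ≤ c k := fun T => by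
    filter_upwards [hM', hl (tendsto_atTop.1 (hy.tendsto_dist p) (T + M))] with k h₁ h₂
    have : c k + gromovProduct p (x k) (y k) = dist p (y k) := by
      simp only [hc, gromovProduct, dist_comm (y k) p, dist_comm (y k) (x k)]; ring
    linarith
  have hx_dist : ∀ k t, -a k ≤ t → t ≤ c k → dist (x k) (f k (a k + t)) = a k + t :=
    fun k t h₁ h₂ => by
      have := hf k 0 ⟨le_rfl, dist_nonneg⟩ (a k + t) ⟨by linarith, by linarith [hac k]⟩
      rwa [hf₀, zero_sub, abs_neg, abs_of_nonneg (by linarith)] at this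
  have hy_dist : ∀ k t, -a k ≤ t → t ≤ c k → dist (f k (a k + t)) (y k) = c k - t :=
    fun k t h₁ h₂ => by
      have := hf k (a k + t) ⟨by linarith, by linarith [hac k]⟩ _ ⟨dist_nonneg, le_rfl⟩
      rw [hf₁, abs_of_nonpos (by linarith [hac k])] at this
      linarith [hac k]
  have hcentre : ∀ k, gromovProduct p (x k) (y k) ≤ M → dist p (f k (a k)) ≤ M + 2 * δ :=
    fun k hk => by
      have h₁ := hx_dist k 0 (by linarith [ha₀ k]) (hc₀ k)
      have h₂ := hy_dist k 0 (by linarith [ha₀ k]) (hc₀ k)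
      rw [add_zero] at h₁ h₂
      have := (hX.isHyperbolicFrom_dist p).le_relProduct (x := x k) (y := y k) (z := f k (a k))
        (by rw [h₁]; simp only [ha, gromovProduct, dist_comm (x k) p]; ring)
        (by rw [h₂]; simp only [hc, gromovProduct, dist_comm (y k) p, dist_comm (y k) (x k)]; ring)
      rw [relProduct_dist] at this
      linarith
  obtain ⟨σ, hσ, hlim⟩ := exists_isometry_limit (hyperfilter ℕ)
    (f := fun k (t : ℝ) => f k (a k + t)) (fun s t => by
      filter_upwards [haT (-s), haT (-t), hcT s, hcT t] with k h₁ h₂ h₃ h₄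
      rw [hf k _ ⟨by linarith, by linarith [hac k]⟩ _ ⟨by linarith, by linarith [hac k]⟩,
        Real.dist_eq, add_sub_add_left_eq_sub]) p (a₀ := 0) (C := M + 2 * δ)
      (hM'.mono fun k hk => by rw [add_zero, dist_comm]; exact hcentre k hk)
  have hnear : ∀ t, ∀ᶠ k in (hyperfilter ℕ : Filter ℕ), dist (f k (a k + t)) (σ t) < 1 := fun t =>
    (hlim t).eventually (Metric.ball_mem_nhds _ one_pos)
  refine ⟨σ, hσ, convergesTo_of_le_gromovProduct hX hx p hl (C := 1 + (M + 2 * δ)) fun n => ?_,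
    convergesTo_of_le_gromovProduct hX hy p hl (C := 1 + (M + 2 * δ)) fun n => ?_⟩
  · have hn₀ : (0 : ℝ) ≤ n := n.cast_nonneg
    filter_upwards [hM', haT n, hnear (-n)] with k h₁ h₂ h₃
    have h₄ := gromovProduct_le_add_dist_left p (f k (a k + -n)) (σ (-n)) (x k)
    have h₅ := gromovProduct_le_add_dist (f k (a k)) p (f k (a k + -n)) (x k)
    have h₆ := hcentre k h₁
    rw [dist_comm] at h₆
    have e₁ := hx_dist k (-n) (by linarith) (by linarith [hc₀ k])
    have e₂ := hx_dist k 0 (by linarith [ha₀ k]) (hc₀ k)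
    have e₃ := hf k (a k) ⟨ha₀ k, by linarith [hac k, hc₀ k]⟩ (a k + -n)
      ⟨by linarith, by linarith [hac k, hc₀ k]⟩
    rw [abs_of_nonneg (by linarith)] at e₃
    rw [add_zero] at e₂
    have e₄ : gromovProduct (f k (a k)) (f k (a k + -n)) (x k) = n := by
      unfold gromovProduct; rw [e₃, dist_comm (f k (a k)) (x k), e₂, dist_comm _ (x k), e₁]; ring
    linarith
  · have hn₀ : (0 : ℝ) ≤ n := n.cast_nonneg
    filter_upwards [hM', hcT n, hnear n] with k h₁ h₂ h₃
    have h₄ := gromovProduct_le_add_dist_left p (f k (a k + n)) (σ n) (y k)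
    have h₅ := gromovProduct_le_add_dist (f k (a k)) p (f k (a k + n)) (y k)
    have h₆ := hcentre k h₁
    rw [dist_comm] at h₆
    have e₁ := hy_dist k n (by linarith [ha₀ k]) h₂
    have e₂ := hy_dist k 0 (by linarith [ha₀ k]) (hc₀ k)
    have e₃ := hf k (a k) ⟨ha₀ k, by linarith [hac k, hc₀ k]⟩ (a k + n)
      ⟨by linarith [ha₀ k], by linarith [hac k, hc₀ k]⟩
    rw [abs_of_nonpos (by linarith)] at e₃
    rw [add_zero] at e₂
    have e₄ : gromovProduct (f k (a k)) (f k (a k + n)) (y k) = n := by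
      unfold gromovProduct; rw [e₃, e₂, e₁]; ring
    linarith

end Existence

/-! ### Constructing the metric, and what a given one implies. -/

section VisualMetric

variable {X : Type u} [MetricSpace X] {δ ε : ℝ} {p : X} {ξ : Boundary X} {γ : ℝ≥0 → X}

/-- A parabolic visual metric exists as soon as there is a ray to `ξ` and any two other boundary
points are joined by a complete geodesic. -/
theorem exists_isParabolicVisualMetric (hδ : 0 ≤ δ) (hX : IsHyperbolic δ X) (hγ : IsRay p ξ γ)
    (hlines : ∀ η₁ η₂ : Boundary X, η₁ ≠ η₂ → ∃ σ, IsCompleteGeodesic η₁ η₂ σ)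
    (hε : 0 < ε) (hε' : ε * (20 * δ) ≤ Real.log 2) :
    ∃ d : MetricSpace (PuncturedBoundary ξ), IsParabolicVisualMetric ξ p ε d := by
  classical
  set h : PuncturedBoundary ξ → PuncturedBoundary ξ → ℝ :=
    fun x y => (height ξ p x.1 y.1).toReal with h_def
  have hh : ∀ x y, x ≠ y → height ξ p x.1 y.1 = h x y := fun x y hxy => by
    obtain ⟨σ, hσ⟩ := hlines x.1 y.1 (Subtype.coe_injective.ne hxy)
    exact (EReal.coe_toReal (height_ne_top hδ hX hγ hσ)
      (height_ne_bot hδ hX hγ x.2 y.2)).symm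
  set D : PuncturedBoundary ξ → PuncturedBoundary ξ → ℝ≥0 :=
    fun x y => if x = y then 0 else (Real.exp (-(ε * h x y))).toNNReal with hD
  have hD_coe : ∀ x y, x ≠ y → (D x y : ℝ) = Real.exp (-(ε * h x y)) := fun x y hxy => by
    simp only [hD, if_neg hxy, Real.coe_toNNReal _ (Real.exp_pos _).le]
  have hD_self : ∀ x, D x x = 0 := fun x => if_pos rfl
  have hD_comm : ∀ x y, D x y = D y x := fun x y => by
    simp only [hD, h_def, height_comm ξ p x.1 y.1, eq_comm (a := x)]
  set K : ℝ≥0 := (Real.exp (ε * (10 * δ))).toNNReal with hK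
  have hK_coe : (K : ℝ) = Real.exp (ε * (10 * δ)) := Real.coe_toNNReal _ (Real.exp_pos _).le
  have hK_one : 1 ≤ K := by
    rw [← NNReal.coe_le_coe, hK_coe]
    exact Real.one_le_exp (by positivity)
  -- This fixes the bound on `ε`: a chain of three steps costs `K` twice, and Frink's construction
  -- tolerates a factor `2`.
  have hK_sq : K * K ≤ 2 := by
    rw [← NNReal.coe_le_coe, NNReal.coe_mul, hK_coe, ← Real.exp_add]
    exact (Real.exp_le_exp.2 (by linarith)).trans (Real.exp_log two_pos).le
  have hD_tri : ∀ x y z, D x z ≤ K * max (D x y) (D y z) := fun x y z => by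
    by_cases hxz : x = z
    · rw [hxz, hD_self]; exact zero_le
    by_cases hxy : x = y
    · rw [hxy]; exact (le_max_right _ _).trans (le_mul_of_one_le_left zero_le hK_one)
    by_cases hyz : y = z
    · rw [← hyz]; exact (le_max_left _ _).trans (le_mul_of_one_le_left zero_le hK_one)
    obtain ⟨σ, hσ⟩ := hlines x.1 y.1 (Subtype.coe_injective.ne hxy)
    obtain ⟨τ, hτ⟩ := hlines y.1 z.1 (Subtype.coe_injective.ne hyz)
    have h₁ := sub_le_height hδ hX hγ x.2 y.2 z.2 hσ hτ (L := min (h x y) (h y z))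
      (by rw [hh _ _ hxy]; exact EReal.coe_le_coe_iff.2 (min_le_left _ _))
      (by rw [hh _ _ hyz]; exact EReal.coe_le_coe_iff.2 (min_le_right _ _))
    rw [hh _ _ hxz, EReal.coe_le_coe_iff] at h₁
    have key : ∀ u v, u ≠ v → h u v - 10 * δ ≤ h x z → D x z ≤ K * D u v := fun u v huv hle => by
      rw [← NNReal.coe_le_coe, NNReal.coe_mul, hK_coe, hD_coe _ _ hxz, hD_coe _ _ huv,
        ← Real.exp_add, Real.exp_le_exp]
      nlinarith [mul_le_mul_of_nonneg_left hle hε.le]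
    rcases min_choice (h x y) (h y z) with hm | hm
    · exact (key x y hxy (hm ▸ h₁)).trans (mul_le_mul_right (le_max_left _ _) K)
    · exact (key y z hyz (hm ▸ h₁)).trans (mul_le_mul_right (le_max_right _ _) K)
  have hD_four : ∀ x₁ x₂ x₃ x₄,
      D x₁ x₄ ≤ 2 * max (D x₁ x₂) (max (D x₂ x₃) (D x₃ x₄)) := fun x₁ x₂ x₃ x₄ => by
    have hM : max (D x₁ x₂) (K * max (D x₂ x₃) (D x₃ x₄)) ≤
        K * max (D x₁ x₂) (max (D x₂ x₃) (D x₃ x₄)) :=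
      max_le ((le_max_left _ _).trans (le_mul_of_one_le_left zero_le hK_one))
        (mul_le_mul_right (le_max_right _ _) K)
    calc D x₁ x₄ ≤ K * max (D x₁ x₂) (D x₂ x₄) := hD_tri _ _ _
      _ ≤ K * max (D x₁ x₂) (K * max (D x₂ x₃) (D x₃ x₄)) :=
        mul_le_mul_right (max_le_max_left _ (hD_tri _ _ _)) K
      _ ≤ K * (K * max (D x₁ x₂) (max (D x₂ x₃) (D x₃ x₄))) := mul_le_mul_right hM K
      _ ≤ 2 * max (D x₁ x₂) (max (D x₂ x₃) (D x₃ x₄)) := by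
        rw [← mul_assoc]; exact mul_le_mul_left hK_sq _
  have hle := PseudoMetricSpace.dist_ofPreNNDist_le D hD_self hD_comm
  have hge := PseudoMetricSpace.le_two_mul_dist_ofPreNNDist D hD_self hD_comm hD_four
  refine ⟨{ PseudoMetricSpace.ofPreNNDist D hD_self hD_comm with
    eq_of_dist_eq_zero := fun {x y} hxy => ?_ }, fun x y hxy => ?_⟩
  · by_contra hne
    have h₁ := hge x y
    rw [hD_coe _ _ hne] at h₁
    refine absurd h₁ (not_le.2 ?_)
    erw [hxy]
    rw [mul_zero]
    exact Real.exp_pos _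
  · rw [parabolicKernel_of_height_eq (hh x y hxy), ← hD_coe _ _ hxy]
    refine ⟨?_, ENNReal.ofReal_le_ofReal (hle x y)⟩
    rw [ENNReal.div_le_iff_le_mul (by simp) (by simp), mul_comm, ← ENNReal.ofReal_ofNat,
      ← ENNReal.ofReal_mul zero_le_two]
    exact ENNReal.ofReal_le_ofReal (hge x y)

/-- A finite positive distance excludes heights `⊥` and `⊤`. Thus the metric itself supplies
geodesics, and then a ray, without properness. -/
theorem IsParabolicVisualMetric.exists_height_eq [d : MetricSpace (PuncturedBoundary ξ)]
    (hd : IsParabolicVisualMetric ξ p ε d) (hε : 0 < ε) {x y : PuncturedBoundary ξ}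
    (hxy : x ≠ y) : ∃ h : ℝ, height ξ p x.1 y.1 = h ∧ Real.exp (-(ε * h)) ≤ 2 * dist x y ∧
      dist x y ≤ Real.exp (-(ε * h)) := by
  obtain ⟨h₁, h₂⟩ := hd x y hxy
  have hpos : 0 < dist x y := dist_pos.2 hxy
  generalize hH : height ξ p x.1 y.1 = H
  induction H with
  | bot =>
    have : parabolicKernel ξ p ε x.1 y.1 = ⊤ := by
      rw [parabolicKernel, hH, EReal.coe_mul_bot_of_pos hε, EReal.neg_bot, EReal.exp_top]
    rw [this, ENNReal.top_div_of_ne_top (by simp), top_le_iff] at h₁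
    exact absurd h₁ ENNReal.ofReal_ne_top
  | top =>
    have : parabolicKernel ξ p ε x.1 y.1 = 0 := by
      rw [parabolicKernel, hH, EReal.coe_mul_top_of_pos hε, EReal.neg_top, EReal.exp_bot]
    rw [this, nonpos_iff_eq_zero, ENNReal.ofReal_eq_zero] at h₂
    exact absurd h₂ (not_le.2 hpos)
  | coe h =>
    rw [parabolicKernel_of_height_eq hH] at h₁ h₂
    refine ⟨h, rfl, ?_, (ENNReal.ofReal_le_ofReal_iff (Real.exp_pos _).le).1 h₂⟩
    rw [ENNReal.div_le_iff_le_mul (by simp) (by simp), mul_comm _ (2 : ℝ≥0∞),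
      ← ENNReal.ofReal_ofNat, ← ENNReal.ofReal_mul zero_le_two] at h₁
    exact (ENNReal.ofReal_le_ofReal_iff (by positivity)).1 h₁

theorem exists_isCompleteGeodesic_of_height_lt {η₁ η₂ : Boundary X} {U : EReal}
    (h : height ξ p η₁ η₂ < U) :
    ∃ σ, IsCompleteGeodesic η₁ η₂ σ ∧ ∃ t, busemann ξ p (σ t) < U := by
  simpa only [height, heightAlong, iInf_lt_iff, exists_prop] using h

theorem exists_isRay_of_height_eq {η₁ η₂ : Boundary X} {h : ℝ} (hh : height ξ p η₁ η₂ = h) :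
    ∃ γ, IsRay p ξ γ := by
  obtain ⟨σ, hσ, -⟩ := exists_isCompleteGeodesic_of_height_lt (hh ▸ EReal.coe_lt_top h)
  by_contra! hno
  have hbot : busemann ξ p (σ 0) = ⊥ := by simp [busemann, hno]
  have := hσ.height_le (ξ := ξ) (p := p) 0
  rw [hbot, hh, le_bot_iff] at this
  exact EReal.coe_ne_bot _ this

end VisualMetric

/-! ### Bounded growth at every larger scale. -/

section Covering

variable {X : Type u} [MetricSpace X]

/-- In a geodesic space of bounded growth at some scale, large balls are covered by a bounded
number of balls of a fixed radius. -/
theorem exists_card_le_cover (hG : IsGeodesicSpace X) {r R : ℝ} (hr : 0 < r) (hR : r < R) {N : ℕ}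
    (hN : ∀ x : X, ∃ s : Finset X, s.card ≤ N ∧ Metric.ball x R ⊆ ⋃ c ∈ s, Metric.ball c r)
    (A : ℝ) : ∃ M : ℕ, ∀ x : X, ∃ s : Finset X, s.card ≤ M ∧
      Metric.ball x A ⊆ ⋃ c ∈ s, Metric.ball c r := by
  classical
  set e := (R - r) / 2 with he
  have he₀ : 0 < e := by linarith
  have key : ∀ k : ℕ, ∃ M : ℕ, ∀ x : X, ∃ s : Finset X, s.card ≤ M ∧
      Metric.ball x (r + k * e) ⊆ ⋃ c ∈ s, Metric.ball c r := by
    intro k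
    induction k with
    | zero => exact ⟨1, fun x => ⟨{x}, by simp, by simp⟩⟩
    | succ k ih =>
      obtain ⟨M, hM⟩ := ih
      choose t ht htc using hN
      refine ⟨M * N, fun x => ?_⟩
      obtain ⟨s, hs, hsc⟩ := hM x
      refine ⟨s.biUnion t, (Finset.card_biUnion_le_card_mul s t N fun c _ => ht c).trans
        (Nat.mul_le_mul_right N hs), fun y hy => ?_⟩
      rw [Metric.mem_ball, dist_comm] at hy
      push_cast at hy
      obtain ⟨γ, h₀, h₁, hγ⟩ := hG x y
      -- Step back from `y` by `e`, stopping at `x`; a center within `r` of `γ a` is within `r + e <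
      -- R` of `y`.
      set a := max 0 (dist x y - e) with ha
      have ha₀ : 0 ≤ a := le_max_left _ _
      have ha₁ : a ≤ dist x y := max_le dist_nonneg (by linarith)
      have ha₂ : dist x y - e ≤ a := le_max_right _ _
      have ha₃ : a < r + k * e := max_lt (by positivity) (by linarith)
      have d₁ := hγ 0 ⟨le_rfl, dist_nonneg⟩ a ⟨ha₀, ha₁⟩
      have d₂ := hγ a ⟨ha₀, ha₁⟩ _ ⟨dist_nonneg, le_rfl⟩
      rw [h₀, zero_sub, abs_neg, abs_of_nonneg ha₀] at d₁
      rw [h₁, abs_of_nonpos (by linarith)] at d₂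
      have hz := hsc (show γ a ∈ Metric.ball x (r + k * e) by
        rw [Metric.mem_ball, dist_comm]; linarith)
      simp only [Set.mem_iUnion, Metric.mem_ball, exists_prop] at hz
      obtain ⟨c, hc, hcz⟩ := hz
      have hy' := htc c (show y ∈ Metric.ball c R by
        rw [Metric.mem_ball, dist_comm]
        rw [dist_comm] at hcz
        linarith [dist_triangle c (γ a) y])
      simp only [Set.mem_iUnion, exists_prop] at hy' ⊢
      obtain ⟨c', hc', hyc'⟩ := hy'
      exact ⟨c', Finset.mem_biUnion.2 ⟨c, hc, hc'⟩, hyc'⟩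
  obtain ⟨k, hk⟩ := exists_nat_ge ((A - r) / e)
  rw [div_le_iff₀ he₀] at hk
  obtain ⟨M, hM⟩ := key k
  refine ⟨M, fun x => ?_⟩
  obtain ⟨s, hs, hsc⟩ := hM x
  exact ⟨s, hs, (Metric.ball_subset_ball (by linarith)).trans hsc⟩

end Covering

/-! ### Geodesics sharing an endpoint, and the doubling property. -/

section Doubling

variable {X : Type u} [MetricSpace X] {δ ε : ℝ} {p : X} {ξ η η₁ η₂ : Boundary X} {γ : ℝ≥0 → X}
  {σ τ : ℝ → X} {L U s t : ℝ}

/-- The lower bound on the product of `σ s` and `σ t` forces the Busemann function to rise at unit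
rate beyond a low point, up to a constant. -/
theorem IsCompleteGeodesic.add_le_rayBusemann (hδ : 0 ≤ δ) (hX : IsHyperbolic δ X)
    (hγ : IsRay p ξ γ) (hσ : IsCompleteGeodesic η₁ η₂ σ)
    (hL : (L : EReal) ≤ height ξ p η₁ η₂) (hU : rayBusemann γ (σ s) ≤ U) (hst : s ≤ t) :
    2 * L - 12 * δ - U + (t - s) ≤ rayBusemann γ (σ t) := by
  have h := hσ.sub_le_relProduct hδ hX hγ hL s t
  unfold relProduct at h
  rw [hσ.1.dist_eq, Real.dist_eq, abs_of_nonpos (by linarith)] at h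
  linarith

/-- Chaining through the common end `η` bounds the product of `σ s` and `τ t` below; as both have
Busemann value at most `U`, they are close. -/
theorem dist_le_of_isCompleteGeodesic (hδ : 0 ≤ δ) (hX : IsHyperbolic δ X) (hγ : IsRay p ξ γ)
    (hη : η ≠ ξ) (hσ : IsCompleteGeodesic η η₁ σ) (hτ : IsCompleteGeodesic η η₂ τ)
    (hLσ : (L : EReal) ≤ height ξ p η η₁) (hLτ : (L : EReal) ≤ height ξ p η η₂)
    (hs : rayBusemann γ (σ s) ≤ U) (ht : rayBusemann γ (τ t) ≤ U) :
    dist (σ s) (τ t) ≤ 2 * U - 2 * L + 16 * δ := by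
  obtain ⟨n, hn⟩ := (tendsto_atTop.1
    (tendsto_relProduct_rayBusemann hδ hX hγ hσ.2.1 hτ.2.1 hη) (L - 6 * δ)).exists
  have h := (isHyperbolicFrom_rayBusemann hX hγ.1).sub_two_mul_le hδ
    (hσ.sub_le_relProduct hδ hX hγ hLσ s (-(n : ℝ))) hn
    (hτ.sub_le_relProduct hδ hX hγ hLτ (-(n : ℝ)) t)
  unfold relProduct at h
  linarith

/-- At time `T` past the low points the Busemann values have grown by about `T`. Being close there,
the points have a large product, which the chain carries out to the ends. -/
theorem le_height_of_dist_le (hδ : 0 ≤ δ) (hX : IsHyperbolic δ X) (hγ : IsRay p ξ γ)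
    (h₁ : η₁ ≠ ξ) (h₂ : η₂ ≠ ξ)
    (hσ : IsCompleteGeodesic η η₁ σ) (hτ : IsCompleteGeodesic η η₂ τ)
    (hLσ : (L : EReal) ≤ height ξ p η η₁) (hLτ : (L : EReal) ≤ height ξ p η η₂)
    (hs : rayBusemann γ (σ s) ≤ U) (ht : rayBusemann γ (τ t) ≤ U) {T r : ℝ} (hT : 0 ≤ T)
    (hr : 0 ≤ r) (hd : dist (σ (s + T)) (τ (t + T)) ≤ 2 * r) :
    ((2 * L - 16 * δ - U + T - r : ℝ) : EReal) ≤ height ξ p η₁ η₂ := by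
  have hb := isHyperbolicFrom_rayBusemann hX hγ.1
  have hσT := hσ.add_le_rayBusemann hδ hX hγ hLσ hs (by linarith : s ≤ s + T)
  have hτT := hτ.add_le_rayBusemann hδ hX hγ hLτ ht (by linarith : t ≤ t + T)
  have := le_height_of_le_relProduct hδ hX hγ hσ.2.2 hτ.2.2 h₁ h₂
    (L := 2 * L - 12 * δ - U + T - r - 2 * δ) ?_
  · convert this using 2; ring
  · filter_upwards [tendsto_natCast_atTop_atTop.eventually_ge_atTop (s + T),
      tendsto_natCast_atTop_atTop.eventually_ge_atTop (t + T)] with n hns hnt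
    have hσn := hσ.add_le_rayBusemann hδ hX hγ hLσ hs (by linarith : s ≤ n)
    have hτn := hτ.add_le_rayBusemann hδ hX hγ hLτ ht (by linarith : t ≤ n)
    refine hb.sub_two_mul_le hδ (y := σ (s + T)) (z := τ (t + T)) ?_ ?_ ?_ <;> unfold relProduct
    · rw [hσ.1.dist_eq, Real.dist_eq, abs_of_nonneg (by linarith)]
      linarith
    · linarith
    · rw [hτ.1.dist_eq, Real.dist_eq, abs_of_nonpos (by linarith)]
      linarith

theorem IsParabolicVisualMetric.isDoubling (hδ : 0 ≤ δ) (hX : IsHyperbolic δ X)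
    (hG : IsGeodesicSpace X) (hgrowth : HasBoundedGrowthAtSomeScale X) (hε : 0 < ε)
    [d : MetricSpace (PuncturedBoundary ξ)] (hd : IsParabolicVisualMetric ξ p ε d) :
    IsDoubling (PuncturedBoundary ξ) := by
  classical
  rcases subsingleton_or_nontrivial (PuncturedBoundary ξ) with hsub | ⟨x₁, x₂, hne⟩
  · refine ⟨1, fun y R hR => ⟨{y}, by simp, fun z _ => ?_⟩⟩
    simpa [Subsingleton.elim z y] using hR
  obtain ⟨_, hh, -⟩ := hd.exists_height_eq hε hne
  obtain ⟨γ, hγ⟩ := exists_isRay_of_height_eq hh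
  obtain ⟨r, R, hr, hR, N₀, -, hN₀⟩ := hgrowth
  -- A factor `2` in distance is a shift by `c` in height.
  set c := Real.log 2 / ε with hc
  have hc₀ : 0 < c := div_pos (Real.log_pos one_lt_two) hε
  have hcε : ε * c = Real.log 2 := by rw [hc]; field_simp
  -- Chosen so that `le_height_of_dist_le`, with `L = h₀ - c` and `U = h₀ + c + 1`, yields exactly
  -- `h₀ + 2 * c`, hence distance at most `ρ / 4`.
  set T := 5 * c + 16 * δ + 1 + r with hT
  have hT₀ : 0 ≤ T := by positivity
  obtain ⟨N, hN⟩ := exists_card_le_cover hG hr hR hN₀ (4 * c + 2 + 16 * δ + 2 * T + 1)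
  refine ⟨N + 1, fun y ρ hρ => ?_⟩
  set h₀ := -Real.log ρ / ε with hh₀
  have hh₀ε : ε * h₀ = -Real.log ρ := by rw [hh₀]; field_simp
  -- `Q x q`: the point `q` lies below the top of a complete geodesic from `y` to `x`.
  let Q : PuncturedBoundary ξ → X → Prop := fun x q => ∃ σ s, IsCompleteGeodesic y.1 x.1 σ ∧
    ((h₀ - c : ℝ) : EReal) ≤ height ξ p y.1 x.1 ∧ rayBusemann γ (σ s) ≤ h₀ + c + 1 ∧ q = σ (s + T)
  have hQ : ∀ x ∈ Metric.ball y ρ, x ∈ Metric.ball y (ρ / 2) ∨ ∃ q, Q x q := by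
    intro x hx
    by_cases hxy : x = y
    · left; rw [hxy]; exact Metric.mem_ball_self (by positivity)
    obtain ⟨h, hh, h₁, h₂⟩ := hd.exists_height_eq hε (Ne.symm hxy)
    rw [Metric.mem_ball, dist_comm] at hx ⊢
    rcases lt_or_ge (h₀ + c) h with hlt | hle
    · left
      refine h₂.trans_lt ?_
      rw [← Real.lt_log_iff_exp_lt (by positivity), Real.log_div hρ.ne' two_ne_zero]
      nlinarith [mul_lt_mul_of_pos_left hlt hε]
    · right
      -- The height is an infimum that need not be attained; the extra `1` gives room.
      obtain ⟨σ, hσ, s, hs⟩ := exists_isCompleteGeodesic_of_height_lt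
        (U := ((h₀ + c + 1 : ℝ) : EReal)) (by rw [hh, EReal.coe_lt_coe_iff]; linarith)
      refine ⟨_, σ, s, hσ, ?_,
        (EReal.coe_lt_coe_iff.1 ((rayBusemann_le_busemann hγ _).trans_lt hs)).le, rfl⟩
      rw [hh, EReal.coe_le_coe_iff]
      have : -(ε * h) < Real.log (2 * ρ) := by
        rw [Real.lt_log_iff_exp_lt (by positivity)]; linarith
      rw [Real.log_mul two_ne_zero hρ.ne'] at this
      refine le_of_mul_le_mul_left ?_ hε
      rw [mul_sub, hh₀ε, hcε]
      linarith
  have hQ_dist : ∀ x x' q q', Q x q → Q x' q' →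
      dist q q' ≤ 4 * c + 2 + 16 * δ + 2 * T := by
    rintro x x' _ _ ⟨σ, s, hσ, hL, hU, rfl⟩ ⟨τ, t, hτ, hL', hU', rfl⟩
    have h₁ := dist_le_of_isCompleteGeodesic hδ hX hγ y.2 hσ hτ hL hL' hU hU'
    have h₂ := dist_triangle4 (σ (s + T)) (σ s) (τ t) (τ (t + T))
    rw [hσ.1.dist_eq, hτ.1.dist_eq, Real.dist_eq, Real.dist_eq, add_sub_cancel_left,
      sub_add_cancel_left, abs_neg, abs_of_nonneg hT₀] at h₂
    linarith
  have hQ_ball : ∀ x x' q q', Q x q → Q x' q' → dist q q' ≤ 2 * r →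
      x ∈ Metric.ball x' (ρ / 2) := by
    rintro x x' _ _ ⟨σ, s, hσ, hL, hU, rfl⟩ ⟨τ, t, hτ, hL', hU', rfl⟩ hqq
    by_cases hxx : x = x'
    · rw [hxx]; exact Metric.mem_ball_self (by positivity)
    have h₁ := le_height_of_dist_le hδ hX hγ x.2 x'.2 hσ hτ hL hL' hU hU' hT₀ hr.le hqq
    obtain ⟨h, hh, -, h₂⟩ := hd.exists_height_eq hε hxx
    rw [hh, EReal.coe_le_coe_iff] at h₁
    refine h₂.trans_lt ?_
    rw [← Real.lt_log_iff_exp_lt (by positivity), Real.log_div hρ.ne' two_ne_zero]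
    have h₃ : h₀ + 2 * c ≤ h := by linarith
    have := mul_le_mul_of_nonneg_left h₃ hε.le
    linarith [Real.log_pos one_lt_two]
  by_cases hex : ∃ x q, Q x q
  · obtain ⟨x₀, q₀, hq₀⟩ := hex
    obtain ⟨S, hS, hScover⟩ := hN q₀
    -- Each covering ball in `X` becomes one ball in the boundary, centered at any `x` with a point
    -- `q` in it; `y` is the default if there is none.
    have hf : ∀ a : X, ∃ x : PuncturedBoundary ξ,
        ∀ x' q', Q x' q' → q' ∈ Metric.ball a r → x' ∈ Metric.ball x (ρ / 2) := by
      intro a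
      by_cases ha : ∃ x q, Q x q ∧ q ∈ Metric.ball a r
      · obtain ⟨x, q, hq, hqa⟩ := ha
        refine ⟨x, fun x' q' hq' hqa' => hQ_ball _ _ _ _ hq' hq ?_⟩
        rw [Metric.mem_ball] at hqa hqa'
        linarith [dist_triangle_right q' q a]
      · push Not at ha
        exact ⟨y, fun x' q' hq' hqa' => absurd hqa' (ha x' q' hq')⟩
    choose f hf using hf
    refine ⟨insert y (S.image f), (Finset.card_insert_le _ _).trans
      (Nat.add_le_add_right (Finset.card_image_le.trans hS) 1), fun x hx => ?_⟩
    simp only [Set.mem_iUnion, exists_prop]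
    rcases hQ x hx with hx' | ⟨q, hq⟩
    · exact ⟨y, Finset.mem_insert_self _ _, hx'⟩
    · have hqS := hScover (show q ∈ Metric.ball q₀ _ from
        (hQ_dist _ _ _ _ hq hq₀).trans_lt (lt_add_one _))
      simp only [Set.mem_iUnion, exists_prop] at hqS
      obtain ⟨a, ha, hqa⟩ := hqS
      exact ⟨f a, Finset.mem_insert_of_mem (Finset.mem_image_of_mem f ha), hf a x q hq hqa⟩
  · refine ⟨{y}, by simp, fun x hx => ?_⟩
    rcases hQ x hx with hx' | ⟨q, hq⟩
    · simpa using hx'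
    · exact absurd ⟨x, q, hq⟩ hex

end Doubling

end ParabolicVisual

theorem theorem5p5 (δ : ℝ) (hδ : 0 ≤ δ) :
    ∃ ε₀ : ℝ, 0 < ε₀ ∧
      ∀ (X : Type u) [MetricSpace X],
        ParabolicVisual.IsGeodesicSpace X →
        ParabolicVisual.IsHyperbolic δ X →
        ParabolicVisual.HasBoundedGrowthAtSomeScale X →
        ∀ (ξ : ParabolicVisual.Boundary X) (p : X),
          (ProperSpace X → ∀ ε : ℝ, 0 < ε → ε ≤ ε₀ →
            ∃ d : MetricSpace (ParabolicVisual.PuncturedBoundary ξ),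
              ParabolicVisual.IsParabolicVisualMetric ξ p ε d) ∧
          (∀ ε : ℝ, 0 < ε →
            ∀ d : MetricSpace (ParabolicVisual.PuncturedBoundary ξ),
              ParabolicVisual.IsParabolicVisualMetric ξ p ε d →
                @ParabolicVisual.IsDoubling (ParabolicVisual.PuncturedBoundary ξ) d) := by
  have hlog : 0 < Real.log 2 := Real.log_pos one_lt_two
  -- The `+ 1` keeps the denominator positive when `δ = 0`.
  refine ⟨Real.log 2 / (20 * δ + 1), by positivity, fun X _ hG hX hgrowth ξ p => ⟨?_, ?_⟩⟩
  · intro _ ε hε hε₀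
    obtain ⟨γ, hγ⟩ := ParabolicVisual.exists_isRay hG hX p ξ
    refine ParabolicVisual.exists_isParabolicVisualMetric hδ hX hγ
      (fun _ _ hne => ParabolicVisual.exists_isCompleteGeodesic hδ hG hX p hne) hε ?_
    rw [le_div_iff₀ (by positivity)] at hε₀
    linarith
  · intro ε hε d hd
    exact hd.isDoubling hδ hX hG hgrowth hε
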